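/- Work on $\mathbb{R}\times\mathbb{R}^3$ with coordinates $(t,x^1,x^2,x^3)$ and $m$ dependent variables $u=(u^1,\dots,u^m)$. Let $U$ be an open subset of the infinite jet space with coordinates $(t,x,u,\partial u,\partial^2u,\dots)$ (for instance the whole jet space). A differential function is a smooth function on $U$ of finitely many jet coordinates; $D_t,D_1,D_2,D_3$ are the total derivatives, and $\mathrm{Grad}$, $\mathrm{Curl}$ are the gradient and curl formed with $(D_1,D_2,D_3)$. Let $G^a[u]=0$, $a=1,\dots,M$, be a PDE system given by differential functions $G^a$. Let $\mathcal{E}\subset U$ be its solution space, i.e. the set of all jets $(t,x,u(t,x),\partial u(t,x),\dots)$ of smooth solutions $u(t,x)$ defined on open subsets of $\mathbb{R}\times\mathbb{R}^3$ with jets in $U$; $f|_{\mathcal E}$ denotes restriction to $\mathcal{E}$. A local circulatory conservation law is a pair $(\vec T,\Psi)$ of a vector and a scalar differential function with $(D_t\vec T+\mathrm{Grad}\,\Psi)|_{\mathcal E}=0$. It is locally trivial if there is a differential function $\Theta$ with $\vec T|_{\mathcal E}=\mathrm{Grad}\,\Theta|_{\mathcal E}$ and $\Psi|_{\mathcal E}=-D_t\Theta|_{\mathcal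 E}$. A topological circulation conservation law is a vector differential function $\vec X$ with $\mathrm{Curl}\,\vec X|_{\mathcal E}=0$; it is trivial if $\vec X|_{\mathcal E}=\mathrm{Grad}\,\Theta|_{\mathcal E}$ for some differential function $\Theta$. A spatial gradient conservation law is a differential function $F$ with $\mathrm{Grad}\,F|_{\mathcal E}=0$; it is trivial if $F|_{\mathcal E}=h(t)|_{\mathcal E}$ for some smooth function $h$ of $t$ alone (defined for all times $t$ occurring in $U$). Then: 1. If a local circulatory conservation law $(\vec T,\Psi)$ is locally trivial, then its density is curl-free on solutions: $\mathrm{Curl}\,\vec T|_{\mathcal E}=0$. 2. If every topological circulation conservation law of the system is trivial and every spatial gradient conservation law of the system is trivial, then every local circulatory conservation law $(\vec T,\Psi)$ with $\mathrm{Curl}\,\vec T|_{\mathcal E}=0$ is locally trivial. -/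

import Mathlib

open scoped ContDiff

noncomputable section

/-- Coordinates on the infinite jet space of `m` dependent variables `u^α(t, x)` over `ℝ × ℝ³`.
`Sum.inl 0` is the time `t`; `Sum.inl 1`, `Sum.inl 2`, `Sum.inl 3` are the Cartesian coordinates
`x¹, x², x³`; `Sum.inr (α, I)` is the derivative variable `∂^I u^α`, where the multi-index `I`
counts how often each of `t, x¹, x², x³` occurs. -/
abbrev JetCoord (m : ℕ) : Type := Fin 4 ⊕ (Fin m × (Fin 4 → ℕ))

/-- The infinite jet space (with the product topology). -/
abbrev Jet (m : ℕ) : Type := JetCoord m → ℝ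

/-- A differential function on `U`: a smooth function of finitely many jet coordinates. -/
def IsDifferentialFunction {m : ℕ} (U : Set (Jet m)) (f : Jet m → ℝ) : Prop :=
  ∃ (S : Finset (JetCoord m)) (g : (S → ℝ) → ℝ),
    ContDiffOn ℝ ∞ g ((fun (p : Jet m) (c : S) => p c) '' U) ∧
      ∀ p ∈ U, f p = g (fun c : S => p c)

/-- Partial derivative of a function on jet space with respect to one jet coordinate. -/
def jetPartial {m : ℕ} (c : JetCoord m) (f : Jet m → ℝ) (p : Jet m) : ℝ :=
  deriv (fun s : ℝ => f (Function.update p c s)) (p c)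

/-- Total derivative `D_i f = ∂f/∂z^i + ∑_{α, I} u^α_{I + e_i} ∂f/∂u^α_I`, with
`z = (t, x¹, x², x³)`. For a differential function only finitely many terms are nonzero. -/
def totalDeriv {m : ℕ} (i : Fin 4) (f : Jet m → ℝ) (p : Jet m) : ℝ :=
  jetPartial (Sum.inl i) f p +
    ∑ᶠ c : Fin m × (Fin 4 → ℕ),
      p (Sum.inr (c.1, c.2 + Pi.single i 1)) * jetPartial (Sum.inr c) f p

/-- Total spatial gradient. -/
def totalGrad {m : ℕ} (f : Jet m → ℝ) (j : Fin 3) : Jet m → ℝ := totalDeriv j.succ f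

/-- Total spatial curl. -/
def totalCurl {m : ℕ} (F : Fin 3 → Jet m → ℝ) : Fin 3 → Jet m → ℝ :=
  ![fun p => totalDeriv 2 (F 2) p - totalDeriv 3 (F 1) p,
    fun p => totalDeriv 3 (F 0) p - totalDeriv 1 (F 2) p,
    fun p => totalDeriv 1 (F 1) p - totalDeriv 2 (F 0) p]

/-- Partial derivative `∂/∂z^i` of a function on `ℝ × ℝ³`, `z = (t, x¹, x², x³)`. -/
def basePartial (i : Fin 4) (f : (Fin 4 → ℝ) → ℝ) (z : Fin 4 → ℝ) : ℝ :=
  fderiv ℝ f z (Pi.single i 1)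

/-- Mixed partial derivative `∂^I` of a function on `ℝ × ℝ³`. -/
def baseMixedPartial (I : Fin 4 → ℕ) (f : (Fin 4 → ℝ) → ℝ) : (Fin 4 → ℝ) → ℝ :=
  (basePartial 0)^[I 0] ((basePartial 1)^[I 1] ((basePartial 2)^[I 2] ((basePartial 3)^[I 3] f)))

/-- The jet at `z` of a function `u = (u¹, …, u^m)` on `ℝ × ℝ³`. -/
def jetOf {m : ℕ} (u : (Fin 4 → ℝ) → Fin m → ℝ) (z : Fin 4 → ℝ) : Jet m
  | Sum.inl i => z i
  | Sum.inr (α, I) => baseMixedPartial I (fun y => u y α) z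

/-- `u` is a smooth solution of the system `G^a[u] = 0` on the open set `V` of `ℝ × ℝ³`, with jets
in the domain `U` of jet space on which the system is given. -/
def IsSolutionOn {m M : ℕ} (U : Set (Jet m)) (G : Fin M → Jet m → ℝ)
    (V : Set (Fin 4 → ℝ)) (u : (Fin 4 → ℝ) → Fin m → ℝ) : Prop :=
  IsOpen V ∧ ContDiffOn ℝ ∞ u V ∧ ∀ z ∈ V, jetOf u z ∈ U ∧ ∀ a, G a (jetOf u z) = 0

/-- The solution space of the system as a subset of jet space: all jets of smooth solutions.
Agreement of two differential functions on solutions is `Set.EqOn` on this set. -/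
def solutionSpace {m M : ℕ} (U : Set (Jet m)) (G : Fin M → Jet m → ℝ) : Set (Jet m) :=
  {p | ∃ (V : Set (Fin 4 → ℝ)) (u : (Fin 4 → ℝ) → Fin m → ℝ),
    IsSolutionOn U G V u ∧ ∃ z ∈ V, p = jetOf u z}

/-- `(T, Ψ)` is the conserved current of a local circulatory conservation law:
`D_t T + Grad Ψ = 0` on solutions. -/
def IsCirculatoryConservationLaw {m M : ℕ} (U : Set (Jet m)) (G : Fin M → Jet m → ℝ)
    (T : Fin 3 → Jet m → ℝ) (Ψ : Jet m → ℝ) : Prop :=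
  (∀ j, IsDifferentialFunction U (T j)) ∧ IsDifferentialFunction U Ψ ∧
    ∀ j, Set.EqOn (fun p => totalDeriv 0 (T j) p + totalGrad Ψ j p) 0 (solutionSpace U G)

/-- Local triviality of a circulatory conservation law:
`T = Grad Θ` and `Ψ = - D_t Θ` on solutions, for some differential function `Θ`. -/
def IsLocallyTrivialCirculatory {m M : ℕ} (U : Set (Jet m)) (G : Fin M → Jet m → ℝ)
    (T : Fin 3 → Jet m → ℝ) (Ψ : Jet m → ℝ) : Prop :=
  ∃ Θ : Jet m → ℝ, IsDifferentialFunction U Θ ∧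
    (∀ j, Set.EqOn (T j) (totalGrad Θ j) (solutionSpace U G)) ∧
    Set.EqOn Ψ (fun p => -totalDeriv 0 Θ p) (solutionSpace U G)

/-- The vector function `X` is curl-free on solutions. -/
def IsCurlFreeOnSolutions {m M : ℕ} (U : Set (Jet m)) (G : Fin M → Jet m → ℝ)
    (X : Fin 3 → Jet m → ℝ) : Prop :=
  ∀ j, Set.EqOn (totalCurl X j) 0 (solutionSpace U G)

/-- `X` is the density of a topological circulation (spatial curl) conservation law. -/
def IsTopologicalCirculationLaw {m M : ℕ} (U : Set (Jet m)) (G : Fin M → Jet m → ℝ)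
    (X : Fin 3 → Jet m → ℝ) : Prop :=
  (∀ j, IsDifferentialFunction U (X j)) ∧ IsCurlFreeOnSolutions U G X

/-- Triviality of a topological circulation conservation law: `X = Grad Θ` on solutions. -/
def IsTrivialTopologicalCirculation {m M : ℕ} (U : Set (Jet m)) (G : Fin M → Jet m → ℝ)
    (X : Fin 3 → Jet m → ℝ) : Prop :=
  ∃ Θ : Jet m → ℝ, IsDifferentialFunction U Θ ∧
    ∀ j, Set.EqOn (X j) (totalGrad Θ j) (solutionSpace U G)

/-- `F` is the density of a spatial gradient conservation law: `Grad F = 0` on solutions. -/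
def IsSpatialGradientLaw {m M : ℕ} (U : Set (Jet m)) (G : Fin M → Jet m → ℝ)
    (F : Jet m → ℝ) : Prop :=
  IsDifferentialFunction U F ∧ ∀ j, Set.EqOn (totalGrad F j) 0 (solutionSpace U G)

/-- Triviality of a spatial gradient conservation law: on solutions, `F` is a smooth function of
`t` alone (such functions satisfy `Grad F = 0` identically, for every system). -/
def IsTrivialSpatialGradient {m M : ℕ} (U : Set (Jet m)) (G : Fin M → Jet m → ℝ)
    (F : Jet m → ℝ) : Prop :=
  ∃ h : ℝ → ℝ, ContDiffOn ℝ ∞ h ((fun p : Jet m => p (Sum.inl 0)) '' U) ∧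
    Set.EqOn F (fun p => h (p (Sum.inl 0))) (solutionSpace U G)

end

/-! ### Partial derivatives on `ℝ × ℝ³` -/

section BasePartial

variable {V : Set (Fin 4 → ℝ)} {f g : (Fin 4 → ℝ) → ℝ}

/-! A point of the solution space is a jet of a solution `u` on an open set, and along that jet
`D_i` is the ordinary partial derivative of the composite function
(`IsDifferentialFunction.basePartial_comp_jetOf`). Identities on solutions can therefore be
differentiated totally, and total derivatives commute there.

A density equal to `Grad Θ` on solutions is then curl-free by symmetry of second derivatives.
Conversely, a curl-free `T` equals some `Grad Θ`, and conservation gives `Grad (Ψ + D_t Θ) = Grad Ψ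
+ D_t T = 0`. Hence `Ψ + D_t Θ = h(t)`, and with `H' = h` the potential `Θ - H` has the same
gradient and satisfies `Ψ = -D_t (Θ - H)`. As the set of times may be disconnected, `H` comes from
`exists_contDiffOn_hasDerivAt_of_isOpen`. -/

theorem basePartial_congr (hV : IsOpen V) (h : Set.EqOn f g V) (i : Fin 4) :
    Set.EqOn (basePartial i f) (basePartial i g) V := fun z hz => by
  have : f =ᶠ[nhds z] g := Filter.eventuallyEq_of_mem (hV.mem_nhds hz) h
  simp only [basePartial, this.fderiv_eq]

theorem ContDiffOn.basePartial (hV : IsOpen V) (hf : ContDiffOn ℝ ∞ f V) (i : Fin 4) :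
    ContDiffOn ℝ ∞ (basePartial i f) V :=
  (hf.fderiv_of_isOpen hV le_rfl).clm_apply contDiffOn_const

theorem ContDiffOn.iterate_basePartial (hV : IsOpen V) (hf : ContDiffOn ℝ ∞ f V) (i : Fin 4)
    (n : ℕ) : ContDiffOn ℝ ∞ ((_root_.basePartial i)^[n] f) V := by
  induction n with
  | zero => exact hf
  | succ n ih =>
    rw [Function.iterate_succ_apply']
    exact ih.basePartial hV i

theorem basePartial_comm (hV : IsOpen V) (hf : ContDiffOn ℝ ∞ f V) (i j : Fin 4) :
    Set.EqOn (basePartial i (basePartial j f)) (basePartial j (basePartial i f)) V := by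
  intro z hz
  have hfz : ContDiffAt ℝ ∞ f z := hf.contDiffAt (hV.mem_nhds hz)
  have hd : DifferentiableAt ℝ (fderiv ℝ f) z :=
    ((hf.fderiv_of_isOpen (m := ∞) hV le_rfl).contDiffAt (hV.mem_nhds hz)).differentiableAt
      (by simp)
  have key : ∀ a b : Fin 4, basePartial a (basePartial b f) z =
      fderiv ℝ (fderiv ℝ f) z (Pi.single a 1) (Pi.single b 1) := by
    intro a b
    unfold basePartial
    rw [fderiv_clm_apply hd (differentiableAt_const _)]
    simp
  rw [key, key]
  refine (hfz.isSymmSndFDerivAt ?_).eq _ _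
  rw [minSmoothness_of_isRCLikeNormedField]
  exact WithTop.coe_le_coe.2 (le_top (a := (2 : ℕ∞)))

theorem basePartial_iterate_comm (hV : IsOpen V) (hf : ContDiffOn ℝ ∞ f V) (i j : Fin 4)
    (n : ℕ) :
    Set.EqOn (basePartial i ((basePartial j)^[n] f)) ((basePartial j)^[n] (basePartial i f)) V := by
  induction n with
  | zero => exact fun _ _ => rfl
  | succ n ih =>
    rw [Function.iterate_succ_apply', Function.iterate_succ_apply']
    exact (basePartial_comm hV (hf.iterate_basePartial hV j n) i j).trans
      (basePartial_congr hV ih j)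

theorem iterate_basePartial_congr (hV : IsOpen V) (h : Set.EqOn f g V) (i : Fin 4) (n : ℕ) :
    Set.EqOn ((basePartial i)^[n] f) ((basePartial i)^[n] g) V := by
  induction n with
  | zero => exact h
  | succ n ih =>
    rw [Function.iterate_succ_apply', Function.iterate_succ_apply']
    exact basePartial_congr hV ih i

theorem ContDiffOn.baseMixedPartial (hV : IsOpen V) (hf : ContDiffOn ℝ ∞ f V)
    (I : Fin 4 → ℕ) : ContDiffOn ℝ ∞ (baseMixedPartial I f) V :=
  (((hf.iterate_basePartial hV 3 _).iterate_basePartial hV 2 _).iterate_basePartial hV 1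
    _).iterate_basePartial hV 0 _

/-- Mixed partials are composed in a fixed order, so the new derivative must be commuted inwards to
its own block. -/
theorem basePartial_baseMixedPartial (hV : IsOpen V) (hf : ContDiffOn ℝ ∞ f V) (i : Fin 4)
    (I : Fin 4 → ℕ) :
    Set.EqOn (basePartial i (baseMixedPartial I f)) (baseMixedPartial (I + Pi.single i 1) f) V := by
  have h3 := hf.iterate_basePartial hV 3 (I 3)
  have h2 := h3.iterate_basePartial hV 2 (I 2)
  have h1 := h2.iterate_basePartial hV 1 (I 1)
  -- Each `ck` moves `∂_i` past the block of `∂_k`; for a given `i` only blocks `0` to `i` have to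
  -- be crossed.
  have c0 := basePartial_iterate_comm hV h1 i 0 (I 0)
  have c1 := iterate_basePartial_congr hV (basePartial_iterate_comm hV h2 i 1 (I 1)) 0 (I 0)
  have c2 := iterate_basePartial_congr hV (iterate_basePartial_congr hV
    (basePartial_iterate_comm hV h3 i 2 (I 2)) 1 (I 1)) 0 (I 0)
  have c3 := iterate_basePartial_congr hV (iterate_basePartial_congr hV
    (iterate_basePartial_congr hV (basePartial_iterate_comm hV hf i 3 (I 3)) 2 (I 2)) 1 (I 1))
    0 (I 0)
  unfold baseMixedPartial
  fin_cases i <;>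
    simp only [Pi.add_apply, Fin.zero_eta, Fin.mk_one, Fin.reduceFinMk, Pi.single_eq_same, ne_eq,
      Fin.reduceEq, not_false_eq_true, Pi.single_eq_of_ne, add_zero, zero_ne_one, one_ne_zero,
      Function.iterate_succ_apply] at c0 c1 c2 c3 ⊢
  · exact c0
  · exact c0.trans c1
  · exact (c0.trans c1).trans c2
  · exact ((c0.trans c1).trans c2).trans c3

theorem basePartial_add {z : Fin 4 → ℝ} (hf : DifferentiableAt ℝ f z)
    (hg : DifferentiableAt ℝ g z) (i : Fin 4) :
    basePartial i (fun y => f y + g y) z = basePartial i f z + basePartial i g z := by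
  simp only [basePartial, fderiv_fun_add hf hg, add_apply]

end BasePartial

/-! ### Total derivatives of differential functions -/

section Jet

variable {m : ℕ}

/-- The total derivative `D_i` of a jet coordinate. -/
def coordTotalDeriv (i : Fin 4) (p : Jet m) : JetCoord m → ℝ
  | Sum.inl k => if k = i then 1 else 0
  | Sum.inr (α, I) => p (Sum.inr (α, I + Pi.single i 1))

/-- Projection to finitely many coordinates is open. Thus a local representative `g` is smooth on an
open set and its `fderiv` there is meaningful. -/
theorem isOpen_image_restrict {U : Set (Jet m)} (hU : IsOpen U) (S : Finset (JetCoord m)) :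
    IsOpen ((fun (p : Jet m) (c : S) => p c) '' U) :=
  (isOpenMap_fst.comp (Homeomorph.piEquivPiSubtypeProd (· ∈ S) fun _ => ℝ).isOpenMap) U hU

theorem jetPartial_eq {U : Set (Jet m)} (hU : IsOpen U) {f : Jet m → ℝ}
    {S : Finset (JetCoord m)} {g : (S → ℝ) → ℝ}
    (hg : ContDiffOn ℝ ∞ g ((fun (p : Jet m) (c : S) => p c) '' U))
    (hfg : ∀ p ∈ U, f p = g (fun c : S => p c)) {p : Jet m} (hp : p ∈ U) (c : JetCoord m) :
    jetPartial c f p = if h : c ∈ S then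
      fderiv ℝ g (fun c : S => p c) (Pi.single ⟨c, h⟩ 1) else 0 := by
  have hcont : Continuous fun s : ℝ => Function.update p c s :=
    continuous_const.update c continuous_id
  have hev : (fun s : ℝ => f (Function.update p c s)) =ᶠ[nhds (p c)]
      fun s => g (fun d : S => Function.update p c s d) := by
    have : ∀ᶠ s in nhds (p c), Function.update p c s ∈ U :=
      hcont.continuousAt.eventually_mem (hU.mem_nhds (by simpa using hp))
    filter_upwards [this] with s hs using hfg _ hs
  unfold jetPartial
  rw [hev.deriv_eq]
  split_ifs with h
  · have hupd : ∀ s : ℝ, (fun d : S => Function.update p c s d) =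
        Function.update (fun d : S => p d) ⟨c, h⟩ s := by
      intro s
      funext d
      simp only [Function.update_apply, Subtype.ext_iff]
    simp only [hupd]
    have hd : HasFDerivAt g (fderiv ℝ g (fun d : S => p d))
        (Function.update (fun d : S => p d) ⟨c, h⟩ (p c)) := by
      have : Function.update (fun d : S => p d) ⟨c, h⟩ (p c) = fun d : S => p d :=
        Function.update_eq_self (⟨c, h⟩ : S) (fun d : S => p d)
      rw [this]
      exact ((hg.contDiffAt ((isOpen_image_restrict hU S).mem_nhds ⟨p, hp, rfl⟩)).differentiableAt
        (by simp)).hasFDerivAt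
    exact (hd.comp_hasDerivAt (p c) (hasDerivAt_update (fun d : S => p d) ⟨c, h⟩ (p c))).deriv
  · have hupd : ∀ s : ℝ, (fun d : S => Function.update p c s d) = fun d : S => p d := by
      intro s
      funext d
      exact Function.update_of_ne (fun e : (d : JetCoord m) = c => h (e ▸ d.2)) _ _
    simp [hupd]

/-- Coordinates outside `S` contribute nothing, so the `finsum` collapses to a chain-rule sum over
`S`. -/
theorem totalDeriv_eq_sum {U : Set (Jet m)} (hU : IsOpen U) {f : Jet m → ℝ}
    {S : Finset (JetCoord m)} {g : (S → ℝ) → ℝ}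
    (hg : ContDiffOn ℝ ∞ g ((fun (p : Jet m) (c : S) => p c) '' U))
    (hfg : ∀ p ∈ U, f p = g (fun c : S => p c)) {p : Jet m} (hp : p ∈ U) (i : Fin 4) :
    totalDeriv i f p = ∑ c : S, coordTotalDeriv i p c *
      fderiv ℝ g (fun c : S => p c) (Pi.single c 1) := by
  have hJ := jetPartial_eq hU hg hfg hp
  have hsum : ∑ c : S, coordTotalDeriv i p c * fderiv ℝ g (fun c : S => p c) (Pi.single c 1) =
      ∑ c ∈ S, coordTotalDeriv i p c * jetPartial c f p := by
    rw [← Finset.sum_coe_sort S]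
    refine Finset.sum_congr rfl fun c _ => ?_
    rw [hJ c, dif_pos c.2]
  have hzero : ∀ c ∉ S, jetPartial c f p = 0 := fun c hc => by rw [hJ c, dif_neg hc]
  rw [hsum, totalDeriv, ← Finset.toLeft_disjSum_toRight (u := S), Finset.sum_disjSum]
  congr 1
  · simp only [coordTotalDeriv, ite_mul, one_mul, zero_mul, Finset.sum_ite_eq',
      Finset.mem_toLeft]
    split_ifs with h
    · rfl
    · exact hzero _ h
  · rw [finsum_eq_sum_of_support_subset]
    · rfl
    · intro c hc
      by_contra hcS
      refine hc ?_
      have : Sum.inr c ∉ S := fun h => hcS (by simpa using h)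
      simp only [hzero _ this, mul_zero]

theorem IsDifferentialFunction.totalDeriv {U : Set (Jet m)} (hU : IsOpen U) {f : Jet m → ℝ}
    (hf : IsDifferentialFunction U f) (i : Fin 4) :
    IsDifferentialFunction U (totalDeriv i f) := by
  classical
  obtain ⟨S, g, hg, hfg⟩ := hf
  -- The coefficients of `D_i` involve the derivative variables of `S` with their multi-indices
  -- raised by `e_i`.
  let S' : Finset (JetCoord m) := S ∪ S.image (Sum.map id fun c => (c.1, c.2 + Pi.single i 1))
  have hSS' : ∀ c : S, (c : JetCoord m) ∈ S' := fun c => Finset.mem_union_left _ c.2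
  have hshift : ∀ c : S, Sum.map id (fun c => (c.1, c.2 + Pi.single i 1)) (c : JetCoord m) ∈ S' :=
    fun c => Finset.mem_union_right _ (Finset.mem_image_of_mem _ c.2)
  let r : (S' → ℝ) → S → ℝ := fun x c => x ⟨c, hSS' c⟩
  let w : (S' → ℝ) → S → ℝ := fun x c =>
    Sum.elim (fun k => if k = i then 1 else 0) (fun _ => x ⟨_, hshift c⟩) (c : JetCoord m)
  refine ⟨S', fun x => ∑ c : S, w x c * fderiv ℝ g (r x) (Pi.single c 1), ?_, ?_⟩
  · have hr : ContDiff ℝ ∞ r := contDiff_pi.2 fun c => contDiff_apply _ _ _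
    refine ContDiffOn.sum fun c _ => ContDiffOn.mul ?_ (ContDiffOn.clm_apply ?_ contDiffOn_const)
    · refine ContDiff.contDiffOn ?_
      simp only [w]
      generalize hx : hshift c = hc
      rcases c with ⟨_ | c, hcS⟩
      · exact contDiff_const
      · exact contDiff_apply _ _ _
    · refine (hg.fderiv_of_isOpen (m := ∞) (isOpen_image_restrict hU S) le_rfl).comp
        hr.contDiffOn ?_
      rintro _ ⟨p, hp, rfl⟩
      exact ⟨p, hp, rfl⟩
  · intro p hp
    rw [totalDeriv_eq_sum hU hg hfg hp]
    refine Finset.sum_congr rfl fun c _ => ?_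
    congr 1
    rcases c with ⟨_ | c, hcS⟩ <;> rfl

theorem IsDifferentialFunction.comp₂ {U : Set (Jet m)} {f₁ f₂ : Jet m → ℝ}
    (h₁ : IsDifferentialFunction U f₁) (h₂ : IsDifferentialFunction U f₂) {φ : ℝ × ℝ → ℝ}
    (hφ : ContDiff ℝ ∞ φ) : IsDifferentialFunction U (fun p => φ (f₁ p, f₂ p)) := by
  classical
  obtain ⟨S₁, g₁, hg₁, hf₁⟩ := h₁
  obtain ⟨S₂, g₂, hg₂, hf₂⟩ := h₂
  have i₁ : ∀ c : S₁, (c : JetCoord m) ∈ S₁ ∪ S₂ := fun c => Finset.mem_union_left _ c.2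
  have i₂ : ∀ c : S₂, (c : JetCoord m) ∈ S₁ ∪ S₂ := fun c => Finset.mem_union_right _ c.2
  refine ⟨S₁ ∪ S₂, fun x => φ (g₁ fun c => x ⟨c, i₁ c⟩, g₂ fun c => x ⟨c, i₂ c⟩), ?_, ?_⟩
  · refine hφ.comp_contDiffOn (ContDiffOn.prodMk ?_ ?_)
    · refine hg₁.comp (ContDiff.contDiffOn (contDiff_pi.2 fun c => contDiff_apply _ _ _)) ?_
      rintro _ ⟨p, hp, rfl⟩
      exact ⟨p, hp, rfl⟩
    · refine hg₂.comp (ContDiff.contDiffOn (contDiff_pi.2 fun c => contDiff_apply _ _ _)) ?_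
      rintro _ ⟨p, hp, rfl⟩
      exact ⟨p, hp, rfl⟩
  · intro p hp
    simp only [hf₁ p hp, hf₂ p hp]

theorem IsDifferentialFunction.of_coord {U : Set (Jet m)} (c : JetCoord m) {h : ℝ → ℝ}
    (hh : ContDiffOn ℝ ∞ h ((fun p : Jet m => p c) '' U)) :
    IsDifferentialFunction U (fun p => h (p c)) := by
  refine ⟨{c}, fun x => h (x ⟨c, Finset.mem_singleton_self c⟩), ?_, fun p _ => rfl⟩
  refine hh.comp (contDiff_apply _ _ _).contDiffOn ?_
  rintro _ ⟨p, hp, rfl⟩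
  exact ⟨p, hp, rfl⟩

/-! ### Differential functions along jets of smooth functions -/

variable {U : Set (Jet m)} {V : Set (Fin 4 → ℝ)} {u : (Fin 4 → ℝ) → Fin m → ℝ}

theorem contDiffOn_jetOf_apply (hV : IsOpen V) (hu : ContDiffOn ℝ ∞ u V) (c : JetCoord m) :
    ContDiffOn ℝ ∞ (fun z => jetOf u z c) V := by
  rcases c with k | ⟨α, I⟩
  · exact (contDiff_apply ℝ ℝ k).contDiffOn
  · exact (contDiffOn_pi.1 hu α).baseMixedPartial hV I

theorem basePartial_jetOf_apply (hV : IsOpen V) (hu : ContDiffOn ℝ ∞ u V) (c : JetCoord m)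
    (i : Fin 4) {z : Fin 4 → ℝ} (hz : z ∈ V) :
    basePartial i (fun z => jetOf u z c) z = coordTotalDeriv i (jetOf u z) c := by
  rcases c with k | ⟨α, I⟩
  · simp only [jetOf, coordTotalDeriv, basePartial]
    rw [(hasFDerivAt_apply (𝕜 := ℝ) k z).fderiv]
    simp [Pi.single_apply]
  · exact basePartial_baseMixedPartial hV (contDiffOn_pi.1 hu α) i I hz

theorem IsDifferentialFunction.contDiffOn_comp_jetOf {f : Jet m → ℝ}
    (hf : IsDifferentialFunction U f) (hV : IsOpen V) (hu : ContDiffOn ℝ ∞ u V)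
    (hVU : ∀ z ∈ V, jetOf u z ∈ U) : ContDiffOn ℝ ∞ (fun z => f (jetOf u z)) V := by
  obtain ⟨S, g, hg, hfg⟩ := hf
  have hc : ContDiffOn ℝ ∞ (fun z (c : S) => jetOf u z c) V :=
    contDiffOn_pi.2 fun c => contDiffOn_jetOf_apply hV hu c
  exact (hg.comp hc fun z hz => ⟨_, hVU z hz, rfl⟩).congr fun z hz => hfg _ (hVU z hz)

/-- The chain rule for `g` composed with finitely many jet coordinates; the derivative of each
coordinate along the jet is its `coordTotalDeriv`. -/
theorem IsDifferentialFunction.basePartial_comp_jetOf (hU : IsOpen U) {f : Jet m → ℝ}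
    (hf : IsDifferentialFunction U f) (hV : IsOpen V) (hu : ContDiffOn ℝ ∞ u V)
    (hVU : ∀ z ∈ V, jetOf u z ∈ U) (i : Fin 4)
    {z : Fin 4 → ℝ} (hz : z ∈ V) :
    basePartial i (fun z => f (jetOf u z)) z = _root_.totalDeriv i f (jetOf u z) := by
  obtain ⟨S, g, hg, hfg⟩ := hf
  have hcd : ∀ c : S, DifferentiableAt ℝ (fun z => jetOf u z c) z := fun c =>
    ((contDiffOn_jetOf_apply hV hu c).contDiffAt (hV.mem_nhds hz)).differentiableAt (by simp)
  have hgd : DifferentiableAt ℝ g (fun c : S => jetOf u z c) :=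
    (hg.contDiffAt ((isOpen_image_restrict hU S).mem_nhds ⟨_, hVU z hz, rfl⟩)).differentiableAt
      (by simp)
  have hcomp := hgd.hasFDerivAt.comp z (hasFDerivAt_pi.2 fun c => (hcd c).hasFDerivAt)
  rw [basePartial_congr hV (fun y hy => hfg _ (hVU y hy)) i hz]
  refine Eq.trans ?_ (totalDeriv_eq_sum hU hg hfg (hVU z hz) i).symm
  change fderiv ℝ (g ∘ fun z (c : S) => jetOf u z c) z (Pi.single i 1) = _
  rw [hcomp.fderiv, ContinuousLinearMap.comp_apply,
    ← Finset.univ_sum_single (ContinuousLinearMap.pi _ (Pi.single i 1)), map_sum]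
  refine Finset.sum_congr rfl fun c _ => ?_
  rw [← basePartial_jetOf_apply hV hu c i hz, ← smul_eq_mul, ← map_smul, ← Pi.single_smul,
    smul_eq_mul, mul_one]
  rfl

end Jet

/-! ### Antiderivatives on open subsets of the line -/

theorem exists_hasDerivAt_of_isOpen {O : Set ℝ} (hO : IsOpen O) {h : ℝ → ℝ}
    (hh : ContinuousOn h O) : ∃ H : ℝ → ℝ, ∀ t ∈ O, HasDerivAt H (h t) t := by
  classical
  -- One base point is chosen per connected component of `O`, so `b` is locally constant on `O`; its
  -- value off `O` plays no role.
  let b : ℝ → ℝ := fun t => if ht : t ∈ O then O.ordConnectedProj ⟨t, ht⟩ else 0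
  have hb : ∀ t ∈ O, Set.uIcc (b t) t ⊆ O := by
    intro t ht
    have := Set.ordConnectedProj_mem_ordConnectedComponent O ⟨t, ht⟩
    rw [Set.mem_ordConnectedComponent, Set.uIcc_comm] at this
    simpa only [b, dif_pos ht] using this
  refine ⟨fun t => ∫ s in (b t)..t, h s, fun t ht => ?_⟩
  obtain ⟨ε, hε, hball⟩ := Metric.isOpen_iff.1 hO t ht
  have hev : (fun x => ∫ s in (b x)..x, h s) =ᶠ[nhds t] fun x => ∫ s in (b t)..x, h s := by
    filter_upwards [Metric.ball_mem_nhds t hε] with x hx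
    have hsub : Set.uIcc t x ⊆ O :=
      ((convex_ball t ε).ordConnected.uIcc_subset (Metric.mem_ball_self hε) hx).trans hball
    have hx' : x ∈ O := hball hx
    have : b x = b t := by
      simp only [b, dif_pos ht, dif_pos hx']
      refine Set.ordConnectedProj_eq.2 ?_
      rwa [Set.uIcc_comm]
    rw [this]
  refine HasDerivAt.congr_of_eventuallyEq ?_ hev
  refine intervalIntegral.integral_hasDerivAt_right
    ((hh.mono (hb t ht)).intervalIntegrable) ?_ (hh.continuousAt (hO.mem_nhds ht))
  exact hh.stronglyMeasurableAtFilter hO t ht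

theorem exists_contDiffOn_hasDerivAt_of_isOpen {O : Set ℝ} (hO : IsOpen O) {h : ℝ → ℝ}
    (hh : ContDiffOn ℝ ∞ h O) :
    ∃ H : ℝ → ℝ, ContDiffOn ℝ ∞ H O ∧ ∀ t ∈ O, HasDerivAt H (h t) t := by
  obtain ⟨H, hH⟩ := exists_hasDerivAt_of_isOpen hO hh.continuousOn
  refine ⟨H, (contDiffOn_infty_iff_deriv_of_isOpen hO).2 ⟨?_, ?_⟩, hH⟩
  · exact fun t ht => (hH t ht).differentiableAt.differentiableWithinAt
  · exact hh.congr fun t ht => (hH t ht).deriv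

/-! ### Circulatory conservation laws -/

section Laws

variable {m M : ℕ} {U : Set (Jet m)} {G : Fin M → Jet m → ℝ}

theorem IsSolutionOn.mem_solutionSpace {V : Set (Fin 4 → ℝ)} {u : (Fin 4 → ℝ) → Fin m → ℝ}
    (hs : IsSolutionOn U G V u) {z : Fin 4 → ℝ} (hz : z ∈ V) : jetOf u z ∈ solutionSpace U G :=
  ⟨V, u, hs, z, hz, rfl⟩

/-- Differential functions that agree on solutions have total derivatives that agree on
solutions. -/
theorem totalDeriv_eqOn_solutionSpace (hU : IsOpen U) {f g : Jet m → ℝ}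
    (hf : IsDifferentialFunction U f) (hg : IsDifferentialFunction U g)
    (h : Set.EqOn f g (solutionSpace U G)) (i : Fin 4) :
    Set.EqOn (totalDeriv i f) (totalDeriv i g) (solutionSpace U G) := by
  rintro _ ⟨V, u, hs, z, hz, rfl⟩
  have hVU : ∀ z ∈ V, jetOf u z ∈ U := fun z hz => (hs.2.2 z hz).1
  rw [← hf.basePartial_comp_jetOf hU hs.1 hs.2.1 hVU i hz,
    ← hg.basePartial_comp_jetOf hU hs.1 hs.2.1 hVU i hz]
  -- The two functions agree along the jet of `u` on all of the open set `V`, not only at `z`.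
  exact basePartial_congr hs.1 (fun y hy => h (hs.mem_solutionSpace hy)) i hz

/-- Along a solution this is the symmetry of second partial derivatives. -/
theorem totalDeriv_comm_on_solutionSpace (hU : IsOpen U) {f : Jet m → ℝ}
    (hf : IsDifferentialFunction U f) (i j : Fin 4) :
    Set.EqOn (totalDeriv i (totalDeriv j f)) (totalDeriv j (totalDeriv i f))
      (solutionSpace U G) := by
  rintro _ ⟨V, u, hs, z, hz, rfl⟩
  have hVU : ∀ z ∈ V, jetOf u z ∈ U := fun z hz => (hs.2.2 z hz).1
  have key : ∀ a b : Fin 4, totalDeriv a (totalDeriv b f) (jetOf u z) =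
      basePartial a (basePartial b fun y => f (jetOf u y)) z := by
    intro a b
    rw [← (hf.totalDeriv hU b).basePartial_comp_jetOf hU hs.1 hs.2.1 hVU a hz]
    exact basePartial_congr hs.1
      (fun y hy => (hf.basePartial_comp_jetOf hU hs.1 hs.2.1 hVU b hy).symm) a hz
  rw [key, key]
  exact basePartial_comm hs.1 (hf.contDiffOn_comp_jetOf hs.1 hs.2.1 hVU) i j hz

theorem totalDeriv_add_on_solutionSpace (hU : IsOpen U) {f g : Jet m → ℝ}
    (hf : IsDifferentialFunction U f) (hg : IsDifferentialFunction U g) (i : Fin 4) :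
    Set.EqOn (totalDeriv i fun p => f p + g p) (fun p => totalDeriv i f p + totalDeriv i g p)
      (solutionSpace U G) := by
  rintro _ ⟨V, u, hs, z, hz, rfl⟩
  have hVU : ∀ z ∈ V, jetOf u z ∈ U := fun z hz => (hs.2.2 z hz).1
  have hd : ∀ {k : Jet m → ℝ}, IsDifferentialFunction U k →
      DifferentiableAt ℝ (fun y => k (jetOf u y)) z := fun hk =>
    ((hk.contDiffOn_comp_jetOf hs.1 hs.2.1 hVU).contDiffAt (hs.1.mem_nhds hz)).differentiableAt
      (by simp)
  have hfg : IsDifferentialFunction U (fun p => f p + g p) :=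
    hf.comp₂ hg (φ := fun x => x.1 + x.2) (contDiff_fst.add contDiff_snd)
  simp only [← hfg.basePartial_comp_jetOf hU hs.1 hs.2.1 hVU i hz,
    ← hf.basePartial_comp_jetOf hU hs.1 hs.2.1 hVU i hz,
    ← hg.basePartial_comp_jetOf hU hs.1 hs.2.1 hVU i hz]
  exact basePartial_add (hd hf) (hd hg) i

theorem totalDeriv_comp_time {H h : ℝ → ℝ}
    (hH : ∀ t ∈ (fun p : Jet m => p (Sum.inl 0)) '' U, HasDerivAt H (h t) t) (i : Fin 4)
    {p : Jet m} (hp : p ∈ U) :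
    totalDeriv i (fun p : Jet m => H (p (Sum.inl 0))) p =
      if i = 0 then h (p (Sum.inl 0)) else 0 := by
  have hr : ∀ c : Fin m × (Fin 4 → ℕ),
      jetPartial (Sum.inr c) (fun p : Jet m => H (p (Sum.inl 0))) p = 0 := by
    intro c
    simp [jetPartial]
  have hl : jetPartial (Sum.inl i) (fun p : Jet m => H (p (Sum.inl 0))) p =
      if i = 0 then h (p (Sum.inl 0)) else 0 := by
    split_ifs with hi
    · subst hi
      simpa [jetPartial] using (hH _ ⟨p, hp, rfl⟩).deriv
    · simp [jetPartial, Function.update_of_ne (show (Sum.inl 0 : JetCoord m) ≠ Sum.inl i by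
        simpa using Ne.symm hi)]
  simp [totalDeriv, hr, hl]

theorem isCurlFreeOnSolutions_of_eqOn_totalGrad (hU : IsOpen U) {X : Fin 3 → Jet m → ℝ}
    (hX : ∀ j, IsDifferentialFunction U (X j)) {Θ : Jet m → ℝ} (hΘ : IsDifferentialFunction U Θ)
    (h : ∀ j, Set.EqOn (X j) (totalGrad Θ j) (solutionSpace U G)) :
    IsCurlFreeOnSolutions U G X := by
  -- The spatial index `a : Fin 3` corresponds to the base coordinate `a.succ`, index `0` being
  -- time.
  have key : ∀ (a b : Fin 3) p, p ∈ solutionSpace U G →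
      totalDeriv a.succ (X b) p - totalDeriv b.succ (X a) p = 0 := by
    intro a b p hp
    rw [totalDeriv_eqOn_solutionSpace hU (hX b) (hΘ.totalDeriv hU _) (h b) _ hp,
      totalDeriv_eqOn_solutionSpace hU (hX a) (hΘ.totalDeriv hU _) (h a) _ hp, sub_eq_zero]
    exact totalDeriv_comm_on_solutionSpace hU hΘ _ _ hp
  intro j p hp
  fin_cases j
  · exact key 1 2 p hp
  · exact key 2 0 p hp
  · exact key 0 1 p hp

/-- A circulatory conservation law whose density is a gradient on solutions is locally trivial if
all spatial gradient conservation laws are trivial. -/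
theorem IsCirculatoryConservationLaw.isLocallyTrivial (hU : IsOpen U)
    (hgrad : ∀ F : Jet m → ℝ, IsSpatialGradientLaw U G F → IsTrivialSpatialGradient U G F)
    {T : Fin 3 → Jet m → ℝ} {Ψ : Jet m → ℝ} (hT : IsCirculatoryConservationLaw U G T Ψ)
    (htriv : IsTrivialTopologicalCirculation U G T) : IsLocallyTrivialCirculatory U G T Ψ := by
  obtain ⟨hTd, hΨ, hcons⟩ := hT
  obtain ⟨Θ, hΘ, hTΘ⟩ := htriv
  have hmem : ∀ p ∈ solutionSpace U G, p ∈ U := by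
    rintro _ ⟨V, u, hs, z, hz, rfl⟩
    exact (hs.2.2 z hz).1
  have hF : IsDifferentialFunction U (fun p => Ψ p + totalDeriv 0 Θ p) :=
    hΨ.comp₂ (hΘ.totalDeriv hU 0) (φ := fun x => x.1 + x.2) (contDiff_fst.add contDiff_snd)
  -- `Ψ + D_t Θ` is the defect of `Θ` as a potential; its gradient is `Grad Ψ + D_t Grad Θ = Grad Ψ
  -- + D_t T`, which vanishes on solutions.
  obtain ⟨h, hh, hFh⟩ := hgrad _ ⟨hF, fun j p hp => by
    have h1 := totalDeriv_add_on_solutionSpace hU hΨ (hΘ.totalDeriv hU 0) j.succ hp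
    have h2 := totalDeriv_comm_on_solutionSpace hU hΘ j.succ 0 hp
    have h3 := totalDeriv_eqOn_solutionSpace hU (hTd j) (hΘ.totalDeriv hU j.succ) (hTΘ j) 0 hp
    have h4 := hcons j hp
    simp only [totalGrad, Pi.zero_apply] at h1 h4 ⊢
    linarith⟩
  have hO : IsOpen ((fun p : Jet m => p (Sum.inl 0)) '' U) :=
    isOpenMap_eval (X := fun _ : JetCoord m => ℝ) (Sum.inl 0) U hU
  obtain ⟨H, hHs, hH⟩ := exists_contDiffOn_hasDerivAt_of_isOpen hO hh
  have hHneg : ∀ t ∈ (fun p : Jet m => p (Sum.inl 0)) '' U,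
      HasDerivAt (fun t => -H t) (-h t) t := fun t ht => (hH t ht).neg
  have hHd : IsDifferentialFunction U (fun p => -H (p (Sum.inl 0))) :=
    IsDifferentialFunction.of_coord (h := fun t => -H t) (Sum.inl 0) hHs.neg
  -- Subtracting `H(t)` leaves the spatial gradient unchanged and lowers `D_t Θ` by `h`, cancelling
  -- the defect.
  refine ⟨fun p => Θ p + -H (p (Sum.inl 0)),
    hΘ.comp₂ hHd (φ := fun x => x.1 + x.2) (contDiff_fst.add contDiff_snd), ?_, ?_⟩
  · intro j p hp
    have h1 := totalDeriv_add_on_solutionSpace hU hΘ hHd j.succ hp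
    have h2 := totalDeriv_comp_time hHneg j.succ (hmem p hp)
    rw [if_neg (Fin.succ_ne_zero j)] at h2
    have h3 := hTΘ j hp
    simp only [totalGrad] at h1 h3 ⊢
    linarith
  · intro p hp
    have h1 := totalDeriv_add_on_solutionSpace hU hΘ hHd 0 hp
    have h2 := totalDeriv_comp_time hHneg 0 (hmem p hp)
    rw [if_pos rfl] at h2
    have h3 := hFh hp
    simp only at h1 h3 ⊢
    linarith

end Laws

theorem mainTheorem10 {m M : ℕ} (U : Set (Jet m)) (hU : IsOpen U)
    (G : Fin M → Jet m → ℝ) (hG : ∀ a, IsDifferentialFunction U (G a)) :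
    (∀ (T : Fin 3 → Jet m → ℝ) (Ψ : Jet m → ℝ), IsCirculatoryConservationLaw U G T Ψ →
      IsLocallyTrivialCirculatory U G T Ψ → IsCurlFreeOnSolutions U G T) ∧
    ((∀ X : Fin 3 → Jet m → ℝ,
        IsTopologicalCirculationLaw U G X → IsTrivialTopologicalCirculation U G X) →
      (∀ F : Jet m → ℝ, IsSpatialGradientLaw U G F → IsTrivialSpatialGradient U G F) →
      ∀ (T : Fin 3 → Jet m → ℝ) (Ψ : Jet m → ℝ), IsCirculatoryConservationLaw U G T Ψ →
        IsCurlFreeOnSolutions U G T → IsLocallyTrivialCirculatory U G T Ψ) := by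
  refine ⟨?_, ?_⟩
  · rintro T Ψ hT ⟨Θ, hΘ, hTΘ, -⟩
    exact isCurlFreeOnSolutions_of_eqOn_totalGrad hU hT.1 hΘ hTΘ
  · intro hcirc hgrad T Ψ hT hcurl
    exact hT.isLocallyTrivial hU hgrad (hcirc T ⟨hT.1, hcurl⟩)
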